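/- Let $K$ be a field of characteristic zero with algebraic closure $\overline K$, and let $0\le b\le c$ be integers. An algebraic monoid over $K$ is an irreducible variety over $K$ (a reduced separated $K$-scheme of finite type) with an associative multiplication morphism and a unit $e\in M(K)$. Let $M$ be the commutative algebraic monoid on $\mathbb A^3_K$ with product $$(x_1,x_2,x_3)*(y_1,y_2,y_3)=(x_1y_1,\;x_1^b y_2+y_1^b x_2,\;x_1^c y_3+y_1^c x_3).$$ 1. $M$ has no nontrivial twisted forms: if $L/K$ is a finite Galois extension and $M'$ is an algebraic monoid over $K$ such that $M\otimes_K L\cong M'\otimes_K L$ as algebraic monoids over $L$, then $M\cong M'$ as algebraic monoids over $K$. 2. Let $\mathrm{Aut}(M)$ be the functor that sends a field extension $L/K$ to the group of automorphisms of the algebraic monoid $M\otimes_K L$ over $L$. If $b=c$, then $\mathrm{Aut}(M)$ is isomorphic to the functor $L\mapsto \mathrm{GL}_2(L)$; if $b<c$, then it is isomorphic to the functor sending $L$ to the group of lower-triangular matrices in $\mathrm{GL}_2(L)$. In both cases $\left(\begin{smallmatrix}\alpha&\beta\\ \gamma&\delta\end{smallmatrix}\right)$ (with $\beta=0$ if $b<c$)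 corresponds to the automorphism $$(x_1,x_2,x_3)\mapsto(x_1,\;\alpha x_2+\beta x_3,\;\gamma x_1^{c-b}x_2+\delta x_3).$$ 3. In both cases the first Galois cohomology set $$H^1(\mathrm{Gal}_{\overline K/K},\mathrm{Aut}(M))=\varinjlim_L H^1(\mathrm{Gal}_{L/K},\mathrm{Aut}(M)(L)),$$ where $L$ runs over the finite Galois extensions of $K$ inside $\overline K$ and the transition maps are the inflation maps, is trivial, i.e. consists of its base point only. Here, for a finite Galois extension $L/K$ with group $\Gamma$, $H^1(\Gamma,\mathrm{Aut}(M)(L))$ is the set of maps $f\colon\Gamma\to\mathrm{Aut}(M)(L)$ with $f(\tau\rho)=f(\tau)\cdot\tau f(\rho)$, modulo the relation that identifies $f$ with each map $\sigma\mapsto c f(\sigma)\,\sigma(c)^{-1}$, $c\in\mathrm{Aut}(M)(L)$; its base point is the class of the constant map $1$. -/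

import Mathlib

universe u

open CategoryTheory AlgebraicGeometry Opposite

noncomputable section

namespace GaloisMonoid

/-! ### Schemes as functors of points, and algebraic monoids -/

/-- The functor of points `B ↦ Hom_K(Spec B, X)` of a `K`-scheme `X`, on commutative
`K`-algebras. -/
def functorOfPoints (K : Type u) [Field K] (X : Over (Spec (CommRingCat.of K))) :
    CommAlgCat.{u} K ⥤ Type u :=
  (algSpec (CommRingCat.of K)).rightOp ⋙ yoneda.obj X

/-- An algebraic monoid over `K`: an irreducible variety (a reduced, separated `K`-scheme of finite
type whose underlying space is irreducible, in particular non-empty), together with a lift of its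
functor of points to a functor with values in monoids. By the Yoneda lemma such a lift is the same
as an associative multiplication morphism `M × M ⟶ M` with a two-sided unit in `M(K)`. -/
structure AlgebraicMonoid (K : Type u) [Field K] where
  /-- the underlying `K`-scheme -/
  variety : Over (Spec (CommRingCat.of K))
  isReduced : IsReduced variety.left
  irreducible : IrreducibleSpace variety.left
  isSeparated : IsSeparated variety.hom
  locallyOfFiniteType : LocallyOfFiniteType variety.hom
  quasiCompact : QuasiCompact variety.hom
  /-- the monoids `M(B)` of points with values in `K`-algebras `B` -/
  points : CommAlgCat.{u} K ⥤ MonCat.{u}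
  /-- the set underlying `M(B)` is the set of `B`-points of the variety, naturally in `B` -/
  pointsIso : points ⋙ forget MonCat.{u} ≅ functorOfPoints K variety

/-! ### Base change, isomorphisms, twisted forms -/

/-- The base change `F ⊗ L` of a monoid-valued functor `F` on `K`-algebras: `(F ⊗ L)(B) = F(B)` for
every `L`-algebra `B`. An `L`-algebra is given here as a commutative `K`-algebra `B` with a
homomorphism of `K`-algebras `L → B`, and a homomorphism of `L`-algebras is a morphism of
`K`-algebras under `L`. -/
def baseChange {K : Type u} [Field K] (F : CommAlgCat.{u} K ⥤ MonCat.{u})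
    (L : Type u) [Field L] [Algebra K L] : Under (CommAlgCat.of K L) ⥤ MonCat.{u} :=
  Under.forget (CommAlgCat.of K L) ⋙ F

/-- Isomorphism of algebraic monoids over `K`: a natural isomorphism between the functors of points
which respects the monoid structures. -/
def AlgebraicMonoid.IsIsomorphic {K : Type u} [Field K] (M M' : AlgebraicMonoid K) : Prop :=
  Nonempty (M.points ≅ M'.points)

/-- `M'` is a twisted `L/K`-form of `M`: over `L` the two become isomorphic as algebraic monoids. -/
def AlgebraicMonoid.IsTwistedForm {K : Type u} [Field K] (L : Type u) [Field L] [Algebra K L]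
    (M M' : AlgebraicMonoid K) : Prop :=
  Nonempty (baseChange M.points L ≅ baseChange M'.points L)

/-! ### The automorphism group functor -/

/-- `Aut(M)(L)`, the group of automorphisms of the algebraic monoid `M ⊗ L` over `L`.
The product `a * b` is the composition `a ∘ b`. -/
abbrev AutGroup {K : Type u} [Field K] (M : AlgebraicMonoid K)
    (L : Type u) [Field L] [Algebra K L] : Type _ :=
  Aut (baseChange M.points L)

/-- The homomorphism `Aut(M)(L) → Aut(M)(L')` induced by a `K`-homomorphism `h : L → L'`: on the
points with values in an `L'`-algebra `B`, the image of `a` is `a` on the points with values in `B`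
seen as an `L`-algebra through `h`. -/
def autMap {K : Type u} [Field K] (M : AlgebraicMonoid K)
    {L L' : Type u} [Field L] [Algebra K L] [Field L'] [Algebra K L'] (h : L →ₐ[K] L') :
    AutGroup M L →* AutGroup M L' where
  toFun a := NatIso.ofComponents
    (fun B => a.app ((Under.map (CommAlgCat.ofHom h)).obj B))
    (fun f => a.hom.naturality ((Under.map (CommAlgCat.ofHom h)).map f))
  map_one' := rfl
  map_mul' _ _ := rfl

theorem autMap_id {K : Type u} [Field K] (M : AlgebraicMonoid K)
    {L : Type u} [Field L] [Algebra K L] (a : AutGroup M L) :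
    autMap M (AlgHom.id K L) a = a := rfl

theorem autMap_comp {K : Type u} [Field K] (M : AlgebraicMonoid K)
    {L L' L'' : Type u} [Field L] [Algebra K L] [Field L'] [Algebra K L'] [Field L'']
    [Algebra K L''] (h : L →ₐ[K] L') (h' : L' →ₐ[K] L'') (a : AutGroup M L) :
    autMap M (h'.comp h) a = autMap M h' (autMap M h a) := rfl

/-- The action of the Galois group on `Aut(M)(L)`, by functoriality. -/
instance autAction {K : Type u} [Field K] (M : AlgebraicMonoid K)
    (L : Type u) [Field L] [Algebra K L] :
    MulDistribMulAction (L ≃ₐ[K] L) (AutGroup M L) where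
  smul σ a := autMap M (σ : L →ₐ[K] L) a
  one_smul _ := rfl
  mul_smul _ _ _ := rfl
  smul_mul σ a b := map_mul (autMap M (σ : L →ₐ[K] L)) a b
  smul_one σ := map_one (autMap M (σ : L →ₐ[K] L))

theorem smul_eq_autMap {K : Type u} [Field K] (M : AlgebraicMonoid K)
    {L : Type u} [Field L] [Algebra K L] (σ : L ≃ₐ[K] L) (a : AutGroup M L) :
    σ • a = autMap M (σ : L →ₐ[K] L) a := rfl

/-! ### First cohomology with non-abelian coefficients -/

/-- Cocycles of a group `Γ` acting on a (possibly non-abelian) group `A`. -/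
structure Cocycle (Γ A : Type*) [Group Γ] [Group A] [MulDistribMulAction Γ A] where
  toFun : Γ → A
  map_mul : ∀ τ ρ : Γ, toFun (τ * ρ) = toFun τ * τ • toFun ρ

/-- Cocycles `f`, `g` are equivalent if `g(σ) = c f(σ) σ(c)⁻¹` for some `c ∈ A` and all `σ`. -/
def cocycleSetoid (Γ A : Type*) [Group Γ] [Group A] [MulDistribMulAction Γ A] :
    Setoid (Cocycle Γ A) where
  r f g := ∃ c : A, ∀ σ : Γ, g.toFun σ = c * f.toFun σ * (σ • c)⁻¹
  iseqv :=
    { refl := fun f => ⟨1, fun σ => by simp⟩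
      symm := by
        rintro f g ⟨c, hc⟩
        exact ⟨c⁻¹, fun σ => by simp [hc σ, mul_assoc]⟩
      trans := by
        rintro f g k ⟨c, hc⟩ ⟨d, hd⟩
        exact ⟨d * c, fun σ => by simp [hd σ, hc σ, mul_assoc]⟩ }

/-- The set `H¹(Γ, A)`. -/
def H1 (Γ A : Type*) [Group Γ] [Group A] [MulDistribMulAction Γ A] : Type _ :=
  Quotient (cocycleSetoid Γ A)

/-- The cocycle that maps everything to the identity. -/
def trivialCocycle (Γ A : Type*) [Group Γ] [Group A] [MulDistribMulAction Γ A] : Cocycle Γ A where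
  toFun _ := 1
  map_mul _ _ := by simp

/-- The base point of `H¹(Γ, A)`. -/
def H1.base (Γ A : Type*) [Group Γ] [Group A] [MulDistribMulAction Γ A] : H1 Γ A :=
  Quotient.mk (cocycleSetoid Γ A) (trivialCocycle Γ A)

/-! ### The direct limit over the finite Galois subextensions of an algebraic closure -/

/-- For finite Galois extensions `L ≤ L'` of `K` in an algebraic closure, the restriction
homomorphism `Gal(L'/K) → Gal(L/K)`. -/
def galRestrict {K : Type u} [Field K] {L L' : FiniteGaloisIntermediateField K (AlgebraicClosure K)}
    (h : L ≤ L') : (L' ≃ₐ[K] L') →* (L ≃ₐ[K] L) :=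
  letI : Algebra L L' := (IntermediateField.inclusion h).toRingHom.toAlgebra
  haveI : IsScalarTower K L L' := IsScalarTower.of_algebraMap_eq (congrFun rfl)
  AlgEquiv.restrictNormalHom L

theorem inclusion_galRestrict {K : Type u} [Field K]
    {L L' : FiniteGaloisIntermediateField K (AlgebraicClosure K)} (h : L ≤ L') (σ : L' ≃ₐ[K] L')
    (x : L) : IntermediateField.inclusion h (galRestrict h σ x) =
      σ (IntermediateField.inclusion h x) := by
  let _ : Algebra L L' := (IntermediateField.inclusion h).toRingHom.toAlgebra
  have : IsScalarTower K L L' := IsScalarTower.of_algebraMap_eq (congrFun rfl)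
  exact AlgEquiv.restrictNormal_commutes σ L x

theorem autMap_inclusion_smul {K : Type u} [Field K] (M : AlgebraicMonoid K)
    {L L' : FiniteGaloisIntermediateField K (AlgebraicClosure K)} (h : L ≤ L') (σ : L' ≃ₐ[K] L')
    (a : AutGroup M L) :
    autMap M (IntermediateField.inclusion h) (galRestrict h σ • a) =
      σ • autMap M (IntermediateField.inclusion h) a := by
  rw [smul_eq_autMap, smul_eq_autMap, ← autMap_comp, ← autMap_comp]
  congr 2
  ext x
  exact congrArg _ (inclusion_galRestrict h σ x)

/-- The inflation map `H¹(Gal(L/K), Aut(M)(L)) → H¹(Gal(L'/K), Aut(M)(L'))` for `L ≤ L'`, which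
sends the class of `f` to the class of `σ ↦ f(σ|_L)`. -/
def inflation {K : Type u} [Field K] (M : AlgebraicMonoid K)
    {L L' : FiniteGaloisIntermediateField K (AlgebraicClosure K)} (h : L ≤ L') :
    H1 (L ≃ₐ[K] L) (AutGroup M L) → H1 (L' ≃ₐ[K] L') (AutGroup M L') :=
  Quotient.map
    (fun f =>
      { toFun := fun σ => autMap M (IntermediateField.inclusion h) (f.toFun (galRestrict h σ))
        map_mul := fun τ ρ => by
          rw [_root_.map_mul, f.map_mul, _root_.map_mul, autMap_inclusion_smul] })
    (by
      rintro f g ⟨c, hc⟩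
      refine ⟨autMap M (IntermediateField.inclusion h) c, fun σ => ?_⟩
      change autMap M _ (g.toFun _) = _ * autMap M _ (f.toFun _) * _
      rw [hc, _root_.map_mul, _root_.map_mul, map_inv, autMap_inclusion_smul])

/-- `H¹(Gal(K̄/K), Aut(M))`: the direct limit of the sets `H¹(Gal(L/K), Aut(M)(L))` over all finite
Galois extensions `K ≤ L ≤ K̄`, that is, the quotient of their disjoint union by the equivalence
relation generated by identifying every class with its inflations. -/
def GaloisH1 {K : Type u} [Field K] (M : AlgebraicMonoid K) : Type _ :=
  Quot (fun x y : (Σ L : FiniteGaloisIntermediateField K (AlgebraicClosure K),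
      H1 (L ≃ₐ[K] L) (AutGroup M L)) =>
    ∃ h : x.1 ≤ y.1, inflation M h x.2 = y.2)

/-- The base point of `H¹(Gal(K̄/K), Aut(M))`, the class of the trivial cocycles. -/
def GaloisH1.base {K : Type u} [Field K] (M : AlgebraicMonoid K) : GaloisH1 M :=
  Quot.mk _ ⟨⊥, H1.base _ _⟩

/-! ### The monoid on affine 3-space -/

/-- Points of affine 3-space with coordinates in `B`; the exponents `b` and `c` only serve to
select the multiplication. -/
@[ext]
structure SplitPoint (b c : ℕ) (B : Type u) where
  x₁ : B
  x₂ : B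
  x₃ : B

namespace SplitPoint

/-- `(x₁, x₂, x₃) * (y₁, y₂, y₃) = (x₁ y₁, x₁ᵇ y₂ + y₁ᵇ x₂, x₁ᶜ y₃ + y₁ᶜ x₃)`. -/
instance (b c : ℕ) (B : Type u) [CommRing B] : Mul (SplitPoint b c B) where
  mul x y := ⟨x.x₁ * y.x₁, x.x₁ ^ b * y.x₂ + y.x₁ ^ b * x.x₂, x.x₁ ^ c * y.x₃ + y.x₁ ^ c * x.x₃⟩

/-- The unit `(1, 0, 0)`. -/
instance (b c : ℕ) (B : Type u) [CommRing B] : One (SplitPoint b c B) where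
  one := ⟨1, 0, 0⟩

theorem mul_def {b c : ℕ} {B : Type u} [CommRing B] (x y : SplitPoint b c B) :
    x * y = ⟨x.x₁ * y.x₁, x.x₁ ^ b * y.x₂ + y.x₁ ^ b * x.x₂,
      x.x₁ ^ c * y.x₃ + y.x₁ ^ c * x.x₃⟩ := rfl

theorem one_def {b c : ℕ} {B : Type u} [CommRing B] : (1 : SplitPoint b c B) = ⟨1, 0, 0⟩ := rfl

instance (b c : ℕ) (B : Type u) [CommRing B] : CommMonoid (SplitPoint b c B) where
  mul_assoc x y z := by
    ext <;> simp only [mul_def] <;> ring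
  one_mul x := by
    ext <;> simp [mul_def, one_def]
  mul_one x := by
    ext <;> simp [mul_def, one_def]
  mul_comm x y := by
    ext <;> simp only [mul_def] <;> ring

/-- A ring homomorphism acts on points coordinatewise. -/
def map (b c : ℕ) {B B' : Type u} [CommRing B] [CommRing B'] (f : B →+* B') :
    SplitPoint b c B →* SplitPoint b c B' where
  toFun x := ⟨f x.x₁, f x.x₂, f x.x₃⟩
  map_one' := by ext <;> simp [one_def]
  map_mul' x y := by ext <;> simp [mul_def]

end SplitPoint

/-- The functor `B ↦ (B³, *)` from `K`-algebras to monoids. -/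
def splitPoints (K : Type u) [Field K] (b c : ℕ) : CommAlgCat.{u} K ⥤ MonCat.{u} where
  obj B := MonCat.of (SplitPoint b c B)
  map f := MonCat.ofHom (SplitPoint.map b c f.hom.toRingHom)

/-- Affine 3-space `Spec K[X₁, X₂, X₃]` over `K`. -/
def affineThreeSpace (K : Type u) [Field K] : Over (Spec (CommRingCat.of K)) :=
  Over.mk (Spec.map (CommRingCat.ofHom (algebraMap K (MvPolynomial (Fin 3) K))))

/-- Homomorphisms `K[X₁, X₂, X₃] → B` of `K`-algebras are triples of elements of `B`. -/
def evalEquiv (K : Type u) [Field K] (b c : ℕ) (B : CommAlgCat.{u} K) :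
    SplitPoint b c B ≃ (CommAlgCat.of K (MvPolynomial (Fin 3) K) ⟶ B) where
  toFun x := CommAlgCat.ofHom (MvPolynomial.aeval ![x.x₁, x.x₂, x.x₃])
  invFun φ := ⟨φ.hom (MvPolynomial.X 0), φ.hom (MvPolynomial.X 1), φ.hom (MvPolynomial.X 2)⟩
  left_inv x := by ext <;> simp
  right_inv φ := by
    ext i
    fin_cases i <;> simp

/-- A triple of elements of `B` is the same as a `B`-point of affine 3-space. -/
def splitPointsEquiv (K : Type u) [Field K] (b c : ℕ) (B : CommAlgCat.{u} K) :
    SplitPoint b c B ≃ (functorOfPoints K (affineThreeSpace K)).obj B :=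
  let e : (op B ⟶ op (CommAlgCat.of K (MvPolynomial (Fin 3) K))) ≃
      ((algSpec (CommRingCat.of K)).obj (op B) ⟶
        (algSpec (CommRingCat.of K)).obj (op (CommAlgCat.of K (MvPolynomial (Fin 3) K)))) :=
    (algSpec.fullyFaithful (R := CommRingCat.of K)).homEquiv
  (evalEquiv K b c B).trans ((opEquiv _ _).symm.trans e)

/-- This identification is natural in `B`. -/
def splitPointsIso (K : Type u) [Field K] (b c : ℕ) :
    splitPoints K b c ⋙ forget MonCat.{u} ≅ functorOfPoints K (affineThreeSpace K) :=
  NatIso.ofComponents (fun B => (splitPointsEquiv K b c B).toIso)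
    (fun {B B'} f => by
      ext x
      have key : evalEquiv K b c B' (SplitPoint.map b c f.hom.toRingHom x) =
          evalEquiv K b c B x ≫ f := by
        ext i
        fin_cases i <;> simp [evalEquiv] <;> rfl
      have h2 := congrArg (fun t => (algSpec (CommRingCat.of K)).map t.op) key
      simp only [op_comp, Functor.map_comp] at h2
      exact h2)

/-- The monoid structure
`(x₁, x₂, x₃) * (y₁, y₂, y₃) = (x₁ y₁, x₁ᵇ y₂ + y₁ᵇ x₂, x₁ᶜ y₃ + y₁ᶜ x₃)` on affine 3-space. -/
def splitMonoid (K : Type u) [Field K] (b c : ℕ) : AlgebraicMonoid K where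
  variety := affineThreeSpace K
  isReduced := by dsimp [affineThreeSpace]; infer_instance
  irreducible := by
    have : IsDomain (CommRingCat.of (MvPolynomial (Fin 3) K)) :=
      inferInstanceAs (IsDomain (MvPolynomial (Fin 3) K))
    have : IsIntegral (Spec (CommRingCat.of (MvPolynomial (Fin 3) K))) := inferInstance
    exact irreducibleSpace_of_isIntegral (X := Spec (CommRingCat.of (MvPolynomial (Fin 3) K)))
  isSeparated := by dsimp [affineThreeSpace]; infer_instance
  locallyOfFiniteType := by
    dsimp [affineThreeSpace]
    rw [HasRingHomProperty.Spec_iff (P := @LocallyOfFiniteType)]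
    exact RingHom.finiteType_algebraMap.mpr inferInstance
  quasiCompact := by dsimp [affineThreeSpace]; infer_instance
  points := splitPoints K b c
  pointsIso := splitPointsIso K b c

/-- The action of a `2 × 2` matrix `(α β; γ δ)` over `B` on the points of the monoid:
`(x₁, x₂, x₃) ↦ (x₁, α x₂ + β x₃, γ x₁ᶜ⁻ᵇ x₂ + δ x₃)` -/
def matrixAct {b c : ℕ} {B : Type u} [CommRing B] (g : Matrix (Fin 2) (Fin 2) B)
    (x : SplitPoint b c B) : SplitPoint b c B :=
  ⟨x.x₁, g 0 0 * x.x₂ + g 0 1 * x.x₃, g 1 0 * x.x₁ ^ (c - b) * x.x₂ + g 1 1 * x.x₃⟩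

/-- The group of lower-triangular invertible `2 × 2` matrices. -/
def lowerTriangular (L : Type u) [Field L] : Subgroup (GL (Fin 2) L) where
  carrier := {g | g 0 1 = 0}
  one_mem' := by simp
  mul_mem' := by
    intro g h hg hh
    simp only [Set.mem_ofPred_eq] at *
    simp [Matrix.mul_apply, Fin.sum_univ_two, hg, hh]
  inv_mem' := by
    intro g hg
    simp only [Set.mem_ofPred_eq] at *
    simp [Matrix.coe_units_inv, Matrix.inv_def, Matrix.adjugate_fin_two, hg]

/-- The homomorphism of groups of lower-triangular matrices induced by a homomorphism of fields. -/
def lowerTriangularMap {L L' : Type u} [Field L] [Field L'] (h : L →+* L') :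
    lowerTriangular L →* lowerTriangular L' :=
  ((Matrix.GeneralLinearGroup.map (n := Fin 2) h).comp (lowerTriangular L).subtype).codRestrict
    (lowerTriangular L') (fun g => by
      have hg : (g : GL (Fin 2) L) 0 1 = 0 := g.2
      change h ((g : GL (Fin 2) L) 0 1) = 0
      rw [hg, map_zero])

end GaloisMonoid

end

noncomputable section

namespace GaloisMonoid

/-! ### Hilbert 90 for `GL₂` and for lower-triangular matrices -/

/-! Everything rests on computing `Aut(M)(L)` and on Hilbert 90.

By Yoneda an endomorphism of `M ⊗ L` is a triple of polynomials. In characteristic zero it sends the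
torus point `(t, 0, 0)` to `(t ^ n, 0, 0)` and is linear on the unipotent points `(1, u, v)`.
Products of such points fill the dense set `x₁ ≠ 0`, so `n` and a 2 × 2 matrix determine the map.
Invertibility forces `n = 1`; if `b < c`, absence of a pole along `x₁ = 0` forces the upper-right
entry to vanish (`exists_matrix_of_polynomial_aut`, `autEquiv`).

Cocycles in `GL₂(L)` are coboundaries, by averaging a diagonal matrix, which also preserves
lower-triangular shape (`exists_eq_mul_map_inv`). So `H¹` vanishes at every finite level, hence in
the limit.

For a twisted form `e : M ⊗ L ≅ M' ⊗ L`, the cocycle `σ ↦ e⁻¹ ∘ σ(e)` is a coboundary, so `e` can be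
corrected to a Galois-invariant isomorphism. Two `L`-structures on a local `K`-algebra are Galois
conjugate, so the corrected map ignores the `L`-structure (`app_eq_app_of_conjugateIso_eq`), and
faithfully flat descent along `B → B ⊗ L` brings it down to `K` (`nonempty_iso_of_baseChange_iso`).
-/

theorem exists_sum_mul_ne_zero {K L : Type*} [Field K] [Field L] [Algebra K L]
    [FiniteDimensional K L] (a : (L ≃ₐ[K] L) → L) (ha : a 1 ≠ 0) :
    ∃ x : L, ∑ σ, a σ * σ x ≠ 0 := by
  by_contra! h
  -- Dedekind's independence of characters, applied to the distinct automorphisms of `L`.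
  have hli : LinearIndependent L (fun σ : L ≃ₐ[K] L => ((σ : L →* L) : L → L)) :=
    (linearIndependent_monoidHom L L).comp (fun σ : L ≃ₐ[K] L => (σ : L →* L))
      (fun σ τ h => AlgEquiv.ext fun x => DFunLike.congr_fun h x)
  refine ha (Fintype.linearIndependent_iff.mp hli a ?_ 1)
  ext x
  simpa using h x

/-- A cocycle with values in `GL₂(L)` is a coboundary; if it is lower triangular, it is the
coboundary of a lower-triangular matrix. -/
theorem exists_eq_mul_map_inv {K L : Type*} [Field K] [Field L] [Algebra K L]
    [FiniteDimensional K L] (f : (L ≃ₐ[K] L) → GL (Fin 2) L)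
    (hf : ∀ τ ρ, f (τ * ρ) =
      f τ * Matrix.GeneralLinearGroup.map (τ : L →ₐ[K] L).toRingHom (f ρ)) :
    ∃ P : GL (Fin 2) L,
      (∀ σ, f σ = P * (Matrix.GeneralLinearGroup.map (σ : L →ₐ[K] L).toRingHom P)⁻¹) ∧
      ((∀ σ, f σ 0 1 = 0) → P 0 1 = 0) := by
  have h1 : f 1 = 1 := by
    have := hf 1 1
    have hm : Matrix.GeneralLinearGroup.map ((1 : L ≃ₐ[K] L) : L →ₐ[K] L).toRingHom (f 1) =
        f 1 := by
      ext i j; rfl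
    rw [hm, mul_one] at this
    exact left_eq_mul.mp this
  -- The trivializing matrix is `∑ f(σ) σ(diag(m, l))`. Choose `l` so that its lower-right entry
  -- `w₁` is nonzero, then `m` so that the determinant is nonzero: as a sum over `σ m`, the
  -- determinant has coefficient `w₁` at `σ = 1`. A diagonal seed keeps the sum lower triangular
  -- when every `f(σ)` is.
  obtain ⟨l, hl⟩ := exists_sum_mul_ne_zero (K := K) (fun σ => f σ 1 1) (by simp [h1])
  set w₀ := ∑ σ, f σ 0 1 * σ l with hw₀
  set w₁ := ∑ σ, f σ 1 1 * σ l with hw₁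
  obtain ⟨m, hm⟩ := exists_sum_mul_ne_zero (K := K) (fun σ => w₁ * f σ 0 0 - w₀ * f σ 1 0)
    (by simpa [h1] using hl)
  let c : Fin 2 → L := ![m, l]
  let Q : Matrix (Fin 2) (Fin 2) L := Matrix.of fun i j => ∑ σ, f σ i j * σ (c j)
  have hdet : Q.det ≠ 0 := by
    rw [Matrix.det_fin_two]
    convert hm using 1
    simp only [Q, c, Matrix.of_apply, Matrix.cons_val_zero, Matrix.cons_val_one, ← hw₀, ← hw₁]
    simp only [sub_mul, Finset.sum_sub_distrib, mul_assoc, ← Finset.mul_sum]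
    ring
  let P : GL (Fin 2) L := Matrix.GeneralLinearGroup.mkOfDetNeZero Q hdet
  refine ⟨P, fun ρ => ?_, fun h => ?_⟩
  · rw [eq_mul_inv_iff_mul_eq]
    ext i j
    have hP : ∀ i j, P i j = ∑ σ, f σ i j * σ (c j) := fun i j => rfl
    have hM : ∀ k, Matrix.GeneralLinearGroup.map (ρ : L →ₐ[K] L).toRingHom P k j =
        ∑ σ, ρ (f σ k j) * ρ (σ (c j)) := by
      intro k
      change ρ (P k j) = _
      rw [hP, map_sum]
      simp
    rw [Matrix.GeneralLinearGroup.coe_mul, Matrix.mul_apply]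
    simp only [hM, hP]
    -- Substituting `ρσ` for `σ` and using `f(ρσ) = f(ρ) ρ(f(σ))` gives `f(ρ) ρ(P) = P`.
    rw [← Equiv.sum_comp (Equiv.mulLeft ρ) (fun σ => f σ i j * σ (c j))]
    simp only [Equiv.coe_mulLeft, hf, Matrix.GeneralLinearGroup.coe_mul, Matrix.mul_apply,
      Finset.mul_sum, Finset.sum_mul]
    rw [Finset.sum_comm]
    refine Finset.sum_congr rfl fun σ _ => Finset.sum_congr rfl fun k _ => ?_
    rw [mul_assoc]
    rfl
  · change ∑ σ, f σ 0 1 * σ (c 1) = 0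
    simp [h]

/-! ### Polynomials in one variable satisfying functional equations -/

section Polynomials

open Polynomial

variable {L : Type*} [Field L]

theorem eval_aeval_eq (P : MvPolynomial (Fin 3) L) (q : Fin 3 → L[X]) (t : L) :
    (MvPolynomial.aeval q P).eval t = MvPolynomial.eval (fun i => (q i).eval t) P := by
  induction P using MvPolynomial.induction_on with
  | C a => simp
  | add p q hp hq => simp [hp, hq]
  | mul_X p i hp => simp [hp]

variable [CharZero L]

/-- Since 2 has infinite multiplicative order, the substitution `t ↦ 2t` scales distinct monomials
by distinct factors. This single substitution is enough to solve the functional equations below. -/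
theorem two_pow_injective : Function.Injective fun n : ℕ => (2 : L) ^ n := by
  intro m n h
  have h' : ((2 ^ m : ℕ) : L) = ((2 ^ n : ℕ) : L) := by simpa using h
  exact Nat.pow_right_injective le_rfl (Nat.cast_injective h')

theorem coeff_of_eval_two_mul {p q : L[X]} (h : ∀ t, p.eval (2 * t) = q.eval t) (i : ℕ) :
    p.coeff i * 2 ^ i = q.coeff i := by
  have : p.comp (C 2 * X) = q := by
    refine Polynomial.funext fun t => ?_
    simpa using h t
  rw [← this, comp_C_mul_X_coeff]

theorem eval_eq_of_eval_two_mul {p : L[X]} {n : ℕ} (h : ∀ t, p.eval (2 * t) = 2 ^ n * p.eval t)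
    (t : L) : p.eval t = p.eval 1 * t ^ n := by
  have hp : p = C (p.coeff n) * X ^ n := by
    ext i
    have := coeff_of_eval_two_mul (p := p) (q := C (2 ^ n) * p) (fun t => by simpa using h t) i
    rw [coeff_C_mul] at this
    rw [coeff_C_mul, coeff_X_pow]
    split_ifs with hi
    · simp [hi]
    · have h2 : (2 : L) ^ i - 2 ^ n ≠ 0 := sub_ne_zero.mpr fun h => hi (two_pow_injective h)
      rw [mul_zero]
      refine (mul_eq_zero.mp ?_).resolve_left h2
      linear_combination this
  rw [hp]
  simp

/-- The exponent is the degree: leading coefficients in `p(2t) = p(2) p(t)` give `p(2) = 2 ^ deg p`.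
-/
theorem exists_eval_eq_pow {p : L[X]} (h1 : p.eval 1 = 1)
    (h : ∀ s t, p.eval (s * t) = p.eval s * p.eval t) : ∃ n : ℕ, ∀ t, p.eval t = t ^ n := by
  have hp : p ≠ 0 := by rintro rfl; simp at h1
  have hn := coeff_of_eval_two_mul (p := p) (q := C (p.eval 2) * p)
    (fun t => by simpa using h 2 t) p.natDegree
  rw [coeff_C_mul, mul_comm] at hn
  have h2 : (2 : L) ^ p.natDegree = p.eval 2 :=
    mul_right_cancel₀ (leadingCoeff_ne_zero.mpr hp) hn
  refine ⟨p.natDegree, fun t => ?_⟩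
  rw [eval_eq_of_eval_two_mul (p := p) (fun t => by rw [h, h2]), h1, one_mul]

/-- Taking `s = 2` and comparing coefficients leaves only a multiple of `t ^ b`, and `s = t = 1`
gives `p(1) = 0`. The analytic solution `t ^ b log t` is not a polynomial. -/
theorem eval_eq_zero_of_leibniz {p : L[X]} {b : ℕ}
    (h : ∀ s t, p.eval (s * t) = s ^ b * p.eval t + t ^ b * p.eval s) (t : L) :
    p.eval t = 0 := by
  have h1 : p.eval 1 = 0 := by simpa using h 1 1
  have hp : p = C (p.coeff b) * X ^ b := by
    ext i
    have := coeff_of_eval_two_mul (p := p) (q := C (2 ^ b) * p + C (p.eval 2) * X ^ b)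
      (fun t => by simpa [mul_comm (t ^ b)] using h 2 t) i
    rw [coeff_add, coeff_C_mul, coeff_C_mul, coeff_X_pow] at this
    rw [coeff_C_mul, coeff_X_pow]
    split_ifs at this ⊢ with hi
    · simp [hi]
    · have h2 : (2 : L) ^ i - 2 ^ b ≠ 0 := sub_ne_zero.mpr fun h => hi (two_pow_injective h)
      rw [mul_zero]
      refine (mul_eq_zero.mp ?_).resolve_left h2
      linear_combination this
  have h0 : p.coeff b = 0 := by
    rw [hp] at h1
    simpa using h1
  rw [hp, h0]
  simp

theorem eval_eq_of_additive {p : L[X]} (h : ∀ s t, p.eval (s + t) = p.eval s + p.eval t) (t : L) :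
    p.eval t = t * p.eval 1 := by
  rw [eval_eq_of_eval_two_mul (p := p) (n := 1) (fun t => by rw [two_mul, h]; ring)]
  ring

/-- From `p(t) p(-t) = 1`, `p` is a unit of `L[X]`, hence constant. -/
theorem eval_eq_one_of_exponential {p : L[X]} (h0 : p.eval 0 = 1)
    (h : ∀ s t, p.eval (s + t) = p.eval s * p.eval t) (t : L) : p.eval t = 1 := by
  have hu : p * p.comp (-X) = 1 := by
    refine Polynomial.funext fun t => ?_
    simp [← h, h0]
  obtain ⟨a, -, ha⟩ := Polynomial.isUnit_iff.mp (IsUnit.of_mul_eq_one _ hu)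
  rw [← ha] at h0 ⊢
  simpa using h0

/-- Values are known only on the open set `x 0 ≠ 0`; multiplying by `X 0` extends the equality to
all points, and an infinite field detects polynomials. -/
theorem mvPolynomial_eq_of_eval_eq {P Q : MvPolynomial (Fin 3) L}
    (h : ∀ x : Fin 3 → L, x 0 ≠ 0 → MvPolynomial.eval x P = MvPolynomial.eval x Q) : P = Q := by
  refine mul_left_cancel₀ (MvPolynomial.X_ne_zero (R := L) (0 : Fin 3)) ?_
  refine MvPolynomial.funext fun x => ?_
  by_cases hx : x 0 = 0
  · simp [hx]
  · simp [h x hx]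

end Polynomials

/-! ### Polynomial endomorphisms of the split monoid -/

/-- The value of a triple of polynomials at a point with coordinates in an `L`-algebra. -/
def polyEval {b c : ℕ} {L B : Type u} [Field L] [CommRing B] (h : L →+* B)
    (P : SplitPoint b c (MvPolynomial (Fin 3) L)) (x : SplitPoint b c B) : SplitPoint b c B :=
  SplitPoint.map b c (MvPolynomial.eval₂Hom h ![x.x₁, x.x₂, x.x₃]) P

/-- The generic point of affine 3-space over `L`. -/
def genericPoint (b c : ℕ) (L : Type u) [Field L] : SplitPoint b c (MvPolynomial (Fin 3) L) :=
  ⟨MvPolynomial.X 0, MvPolynomial.X 1, MvPolynomial.X 2⟩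

/-- The matrices acting on the monoid: there is no condition if `b = c`, and they are lower
triangular if `b < c`. -/
def IsAdmissible (b c : ℕ) {R : Type*} [CommRing R] (g : Matrix (Fin 2) (Fin 2) R) : Prop :=
  b < c → g 0 1 = 0

theorem SplitPoint.map_matrixAct {b c : ℕ} {B B' : Type u} [CommRing B] [CommRing B']
    (f : B →+* B') (g : Matrix (Fin 2) (Fin 2) B) (x : SplitPoint b c B) :
    SplitPoint.map b c f (matrixAct g x) = matrixAct (g.map f) (SplitPoint.map b c f x) := by
  ext <;> simp [SplitPoint.map, matrixAct]

theorem map_genericPoint {b c : ℕ} {L B : Type u} [Field L] [CommRing B] (h : L →+* B)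
    (x : SplitPoint b c B) :
    SplitPoint.map b c (MvPolynomial.eval₂Hom h ![x.x₁, x.x₂, x.x₃]) (genericPoint b c L) = x := by
  ext <;> simp [SplitPoint.map, genericPoint]

theorem matrixAct_one {b c : ℕ} {B : Type u} [CommRing B] (x : SplitPoint b c B) :
    matrixAct 1 x = x := by
  ext <;> simp [matrixAct]

/-- Composition would put a factor `x₁ ^ (c - b)` on `g 0 1 * h 1 0`. Admissibility removes it:
either the exponent is zero or the entry is. -/
theorem matrixAct_mul {b c : ℕ} (hbc : b ≤ c) {B : Type u} [CommRing B]
    {g h : Matrix (Fin 2) (Fin 2) B} (hg : IsAdmissible b c g) (hh : IsAdmissible b c h)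
    (x : SplitPoint b c B) : matrixAct (g * h) x = matrixAct g (matrixAct h x) := by
  obtain rfl | hlt := hbc.eq_or_lt
  · ext <;> simp [matrixAct, Matrix.mul_apply, Fin.sum_univ_two] <;> ring
  · ext <;> simp [matrixAct, Matrix.mul_apply, Fin.sum_univ_two, hg hlt, hh hlt] <;> ring

theorem matrixAct_map_mul {b c : ℕ} (hbc : b ≤ c) {B : Type u} [CommRing B]
    {g : Matrix (Fin 2) (Fin 2) B} (hg : IsAdmissible b c g) (x y : SplitPoint b c B) :
    matrixAct g (x * y) = matrixAct g x * matrixAct g y := by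
  obtain ⟨d, rfl⟩ := Nat.exists_eq_add_of_le hbc
  rcases Nat.eq_zero_or_pos d with rfl | hd
  · ext <;> simp [matrixAct, SplitPoint.mul_def] <;> ring
  · have h0 : g 0 1 = 0 := hg (by omega)
    ext <;> simp [matrixAct, SplitPoint.mul_def, h0] <;> ring

theorem matrix_eq_of_matrixAct_eq {b c : ℕ} {B : Type u} [CommRing B]
    {g h : Matrix (Fin 2) (Fin 2) B}
    (H : ∀ x : SplitPoint b c B, matrixAct g x = matrixAct h x) : g = h := by
  have h0 := H ⟨1, 1, 0⟩
  have h1 := H ⟨1, 0, 1⟩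
  simp only [matrixAct, SplitPoint.mk.injEq] at h0 h1
  ext i j
  fin_cases i <;> fin_cases j
  · simpa using h0.2.1
  · simpa using h1.2.1
  · simpa using h0.2.2
  · simpa using h1.2.2

section Endomorphisms

variable {L : Type u} [Field L] {b c : ℕ}

/-- Restricting a coordinate of a polynomial map to a parametrized curve gives a polynomial in the
parameter. -/
theorem exists_polynomial_eval (P : MvPolynomial (Fin 3) L) (q : Fin 3 → Polynomial L) :
    ∃ p : Polynomial L, ∀ t, p.eval t =
      MvPolynomial.eval ![(q 0).eval t, (q 1).eval t, (q 2).eval t] P := by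
  refine ⟨MvPolynomial.aeval q P, fun t => ?_⟩
  rw [eval_aeval_eq]
  congr 2
  ext i
  fin_cases i <;> rfl

/-- A point with invertible first coordinate is the product of a point of the torus and a unipotent
point. -/
theorem SplitPoint.eq_mul {x : SplitPoint b c L} (hx : x.x₁ ≠ 0) :
    x = ⟨x.x₁, 0, 0⟩ * ⟨1, x.x₂ / x.x₁ ^ b, x.x₃ / x.x₁ ^ c⟩ := by
  ext <;> simp [SplitPoint.mul_def] <;> field_simp

variable [CharZero L]

/-- A polynomial map respecting the multiplication is, at points with invertible first coordinate,
given by a power of the first coordinate and a linear map of the normalized second and third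
coordinates. -/
theorem exists_form_of_polynomial_hom (P : SplitPoint b c (MvPolynomial (Fin 3) L))
    (hone : polyEval (RingHom.id L) P 1 = 1)
    (hmul : ∀ x y, polyEval (RingHom.id L) P (x * y) =
      polyEval (RingHom.id L) P x * polyEval (RingHom.id L) P y) :
    ∃ (n : ℕ) (g : Matrix (Fin 2) (Fin 2) L), ∀ x : SplitPoint b c L, x.x₁ ≠ 0 →
      polyEval (RingHom.id L) P x = ⟨x.x₁ ^ n,
        (x.x₁ ^ n) ^ b * (g 0 0 * (x.x₂ / x.x₁ ^ b) + g 0 1 * (x.x₃ / x.x₁ ^ c)),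
        (x.x₁ ^ n) ^ c * (g 1 0 * (x.x₂ / x.x₁ ^ b) + g 1 1 * (x.x₃ / x.x₁ ^ c))⟩ := by
  set φ := polyEval (RingHom.id L) P
  have hev : ∀ x, φ x = ⟨MvPolynomial.eval ![x.x₁, x.x₂, x.x₃] P.x₁,
      MvPolynomial.eval ![x.x₁, x.x₂, x.x₃] P.x₂,
      MvPolynomial.eval ![x.x₁, x.x₂, x.x₃] P.x₃⟩ := fun x => rfl
  have torus_mul : ∀ s t : L, (⟨s * t, 0, 0⟩ : SplitPoint b c L) = ⟨s, 0, 0⟩ * ⟨t, 0, 0⟩ := by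
    intro s t
    ext <;> simp [SplitPoint.mul_def]
  have unip_mul : ∀ u v u' v' : L,
      (⟨1, u + u', v + v'⟩ : SplitPoint b c L) = ⟨1, u, v⟩ * ⟨1, u', v'⟩ := by
    intro u v u' v'
    ext <;> simp [SplitPoint.mul_def, add_comm]
  -- the torus
  have htor : ∃ n : ℕ, ∀ t, φ ⟨t, 0, 0⟩ = ⟨t ^ n, 0, 0⟩ := by
    obtain ⟨p₁, hp₁⟩ := exists_polynomial_eval P.x₁ ![Polynomial.X, 0, 0]
    obtain ⟨p₂, hp₂⟩ := exists_polynomial_eval P.x₂ ![Polynomial.X, 0, 0]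
    obtain ⟨p₃, hp₃⟩ := exists_polynomial_eval P.x₃ ![Polynomial.X, 0, 0]
    have hp : ∀ t, φ ⟨t, 0, 0⟩ = ⟨p₁.eval t, p₂.eval t, p₃.eval t⟩ := by
      intro t
      rw [hev, hp₁, hp₂, hp₃]
      simp
    have hm : ∀ s t, (⟨p₁.eval (s * t), p₂.eval (s * t), p₃.eval (s * t)⟩ : SplitPoint b c L) =
        ⟨p₁.eval s, p₂.eval s, p₃.eval s⟩ * ⟨p₁.eval t, p₂.eval t, p₃.eval t⟩ := by
      intro s t
      rw [← hp, ← hp, ← hp, torus_mul, hmul]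
    have h1 : p₁.eval 1 = 1 := by
      have := hp 1
      rw [show (⟨1, 0, 0⟩ : SplitPoint b c L) = 1 from rfl, hone] at this
      exact (congrArg SplitPoint.x₁ this).symm
    obtain ⟨n, hn⟩ := exists_eval_eq_pow h1 (fun s t => congrArg SplitPoint.x₁ (hm s t))
    -- The other two coordinates on the torus obey the twisted Leibniz rule with exponent `n * k`,
    -- where `k` is `b` or `c`, so they vanish.
    have hlin : ∀ (k : ℕ) (q : Polynomial L),
        (∀ s t, q.eval (s * t) = (s ^ n) ^ k * q.eval t + (t ^ n) ^ k * q.eval s) →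
        ∀ t, q.eval t = 0 := by
      intro k q hq
      refine eval_eq_zero_of_leibniz (b := n * k) fun s t => ?_
      rw [hq, pow_mul, pow_mul]
    refine ⟨n, fun t => ?_⟩
    rw [hp, hn, hlin b p₂ _ t, hlin c p₃ _ t]
    · intro s t
      simpa [SplitPoint.mul_def, hn] using congrArg SplitPoint.x₃ (hm s t)
    · intro s t
      simpa [SplitPoint.mul_def, hn] using congrArg SplitPoint.x₂ (hm s t)
  -- the unipotent part
  have hline : ∀ u v t : L, φ ⟨1, t * u, t * v⟩ =
      ⟨1, t * (φ ⟨1, u, v⟩).x₂, t * (φ ⟨1, u, v⟩).x₃⟩ := by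
    intro u v
    let q : Fin 3 → Polynomial L :=
      ![1, Polynomial.X * Polynomial.C u, Polynomial.X * Polynomial.C v]
    obtain ⟨p₁, hp₁⟩ := exists_polynomial_eval P.x₁ q
    obtain ⟨p₂, hp₂⟩ := exists_polynomial_eval P.x₂ q
    obtain ⟨p₃, hp₃⟩ := exists_polynomial_eval P.x₃ q
    have hp : ∀ t, φ ⟨1, t * u, t * v⟩ = ⟨p₁.eval t, p₂.eval t, p₃.eval t⟩ := by
      intro t
      rw [hev, hp₁, hp₂, hp₃]
      simp [q, mul_comm t]
    have hm : ∀ s t, (⟨p₁.eval (s + t), p₂.eval (s + t), p₃.eval (s + t)⟩ : SplitPoint b c L) =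
        ⟨p₁.eval s, p₂.eval s, p₃.eval s⟩ * ⟨p₁.eval t, p₂.eval t, p₃.eval t⟩ := by
      intro s t
      rw [← hp, ← hp, ← hp, add_mul, add_mul, unip_mul, hmul]
    have h0 : p₁.eval 0 = 1 := by
      have := hp 0
      rw [zero_mul, zero_mul, show (⟨1, 0, 0⟩ : SplitPoint b c L) = 1 from rfl, hone] at this
      exact (congrArg SplitPoint.x₁ this).symm
    -- Along a line in the unipotent group the first coordinate is exponential, hence constantly 1;
    -- the other two then become additive, hence linear.
    have h1 := eval_eq_one_of_exponential h0 (fun s t => congrArg SplitPoint.x₁ (hm s t))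
    intro t
    have hφ1 := hp 1
    rw [one_mul, one_mul] at hφ1
    rw [hp, hφ1, h1, eval_eq_of_additive (p := p₂) _ t, eval_eq_of_additive (p := p₃) _ t]
    · intro s t
      simpa [SplitPoint.mul_def, h1, add_comm] using congrArg SplitPoint.x₃ (hm s t)
    · intro s t
      simpa [SplitPoint.mul_def, h1, add_comm] using congrArg SplitPoint.x₂ (hm s t)
  obtain ⟨n, hn⟩ := htor
  let A := φ ⟨1, 1, 0⟩
  let B := φ ⟨1, 0, 1⟩
  -- Since `(1, u, v) = (1, u, 0) * (1, 0, v)`, the images of `(1, 1, 0)` and `(1, 0, 1)` determine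
  -- the map; they supply the two columns of the matrix.
  have hunip : ∀ u v : L, φ ⟨1, u, v⟩ = ⟨1, A.x₂ * u + B.x₂ * v, A.x₃ * u + B.x₃ * v⟩ := by
    intro u v
    have hu := hline 1 0 u
    have hv := hline 0 1 v
    rw [mul_one, mul_zero] at hu hv
    have := unip_mul u 0 0 v
    rw [add_zero, zero_add] at this
    rw [this, hmul, hu, hv]
    ext <;> simp [SplitPoint.mul_def, A, B] <;> ring
  refine ⟨n, !![A.x₂, B.x₂; A.x₃, B.x₃], fun x hx => ?_⟩
  conv_lhs => rw [SplitPoint.eq_mul hx]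
  rw [hmul, hn, hunip]
  ext <;> simp [SplitPoint.mul_def]

/-- A polynomial automorphism of the monoid is given by a matrix. -/
theorem exists_matrix_of_polynomial_aut (hbc : b ≤ c)
    (P Q : SplitPoint b c (MvPolynomial (Fin 3) L))
    (hPone : polyEval (RingHom.id L) P 1 = 1)
    (hPmul : ∀ x y, polyEval (RingHom.id L) P (x * y) =
      polyEval (RingHom.id L) P x * polyEval (RingHom.id L) P y)
    (hQone : polyEval (RingHom.id L) Q 1 = 1)
    (hQmul : ∀ x y, polyEval (RingHom.id L) Q (x * y) =
      polyEval (RingHom.id L) Q x * polyEval (RingHom.id L) Q y)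
    (hPQ : ∀ x, polyEval (RingHom.id L) P (polyEval (RingHom.id L) Q x) = x) :
    ∃ g : Matrix (Fin 2) (Fin 2) L, IsAdmissible b c g ∧
      P = matrixAct (g.map MvPolynomial.C) (genericPoint b c L) := by
  obtain ⟨n, g, hg⟩ := exists_form_of_polynomial_hom P hPone hPmul
  obtain ⟨m, k, hk⟩ := exists_form_of_polynomial_hom Q hQone hQmul
  -- The composite sends `(2, 0, 0)` to a point with first coordinate `2 ^ (m * n)`, which must be
  -- 2.
  have hn : n = 1 := by
    have h2 : ((2 : L) ^ m) ^ n = 2 := by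
      have := hPQ ⟨2, 0, 0⟩
      rw [hk _ (by simp), hg _ (by simp)] at this
      exact congrArg SplitPoint.x₁ this
    rw [← pow_mul] at h2
    exact Nat.eq_one_of_mul_eq_one_left
      (two_pow_injective (L := L) (h2.trans (pow_one 2).symm))
  subst hn
  have hform : ∀ x : SplitPoint b c L, x.x₁ ≠ 0 → polyEval (RingHom.id L) P x = ⟨x.x₁,
      g 0 0 * x.x₂ + g 0 1 * (x.x₁ ^ b * (x.x₃ / x.x₁ ^ c)),
      g 1 0 * x.x₁ ^ (c - b) * x.x₂ + g 1 1 * x.x₃⟩ := by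
    intro x hx
    rw [hg x hx, pow_sub₀ _ hx hbc]
    ext <;> simp <;> field_simp
  have hadm : IsAdmissible b c g := by
    intro hlt
    -- The `x₃`-term of the second coordinate carries `x₁ ^ (b - c)`. Clearing this denominator
    -- gives a polynomial identity, and evaluating it at `(0, 0, 1)` leaves `0 = g 0 1`.
    have hpoly : MvPolynomial.X 0 ^ (c - b) * P.x₂ =
        MvPolynomial.C (g 0 0) * MvPolynomial.X 0 ^ (c - b) * MvPolynomial.X 1 +
          MvPolynomial.C (g 0 1) * MvPolynomial.X 2 := by
      refine mvPolynomial_eq_of_eval_eq fun x hx => ?_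
      have h := congrArg SplitPoint.x₂ (hform ⟨x 0, x 1, x 2⟩ hx)
      have hx3 : ![x 0, x 1, x 2] = x := by ext i; fin_cases i <;> rfl
      change MvPolynomial.eval ![x 0, x 1, x 2] P.x₂ = _ at h
      rw [hx3] at h
      simp only [map_mul, map_add, map_pow, MvPolynomial.eval_X, MvPolynomial.eval_C, h]
      rw [pow_sub₀ _ hx hbc]
      field_simp
    have h0 := congrArg (MvPolynomial.eval ![(0 : L), 0, 1]) hpoly
    simpa [(Nat.sub_pos_of_lt hlt).ne'] using h0.symm
  have hact : ∀ x : SplitPoint b c L, x.x₁ ≠ 0 →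
      polyEval (RingHom.id L) P x = matrixAct g x := by
    intro x hx
    rw [hform x hx]
    obtain rfl | hlt := hbc.eq_or_lt
    · ext <;> simp [matrixAct, mul_div_cancel₀ _ (pow_ne_zero b hx)]
    · ext <;> simp [matrixAct, hadm hlt]
  have hcoord : ∀ x : Fin 3 → L, x 0 ≠ 0 →
      SplitPoint.map b c (MvPolynomial.eval x) P =
        SplitPoint.map b c (MvPolynomial.eval x)
          (matrixAct (g.map MvPolynomial.C) (genericPoint b c L)) := by
    intro x hx
    have hx3 : ![x 0, x 1, x 2] = x := by ext i; fin_cases i <;> rfl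
    have h := hact ⟨x 0, x 1, x 2⟩ hx
    change SplitPoint.map b c (MvPolynomial.eval ![x 0, x 1, x 2]) P = _ at h
    rw [hx3] at h
    rw [h, SplitPoint.map_matrixAct]
    ext <;> simp [matrixAct, SplitPoint.map, genericPoint]
  refine ⟨g, hadm, ?_⟩
  ext1
  · exact mvPolynomial_eq_of_eval_eq fun x hx => congrArg SplitPoint.x₁ (hcoord x hx)
  · exact mvPolynomial_eq_of_eval_eq fun x hx => congrArg SplitPoint.x₂ (hcoord x hx)
  · exact mvPolynomial_eq_of_eval_eq fun x hx => congrArg SplitPoint.x₃ (hcoord x hx)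

end Endomorphisms

/-! ### The automorphism group functor of the split monoid -/

section AutSplit

variable {K : Type u} [Field K] {b c : ℕ} (L : Type u) [Field L] [Algebra K L]

theorem IsAdmissible.map {R S : Type*} [CommRing R] [CommRing S] {b c : ℕ}
    {g : Matrix (Fin 2) (Fin 2) R} (hg : IsAdmissible b c g) (f : R →+* S) :
    IsAdmissible b c (g.map f) := fun h => by simp [hg h]

variable (b c) in
/-- The group of admissible invertible matrices. -/
def admissible : Subgroup (GL (Fin 2) L) where
  carrier := {g | IsAdmissible b c g.val}
  one_mem' := fun _ => by simp
  mul_mem' := by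
    intro g h hg hh hlt
    simp [Matrix.mul_apply, Fin.sum_univ_two, hg hlt, hh hlt]
  inv_mem' := by
    intro g hg hlt
    simp [Matrix.coe_units_inv, Matrix.inv_def, Matrix.adjugate_fin_two, hg hlt]

/-- The group `admissible` lets both cases be treated at once; they separate only here and in the
next lemma. -/
theorem admissible_eq_top : admissible b b L = ⊤ :=
  eq_top_iff.mpr fun _ _ h => absurd h (lt_irrefl b)

theorem admissible_eq_lowerTriangular (h : b < c) : admissible b c L = lowerTriangular L :=
  Subgroup.ext fun _ => ⟨fun hg => hg h, fun hg _ => hg⟩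

variable {L}

theorem isAdmissible_val (g : admissible b c L) : IsAdmissible b c g.1.val := g.2

theorem matrixAct_map_one {B : Type u} [CommRing B] (g : Matrix (Fin 2) (Fin 2) B) :
    matrixAct g (1 : SplitPoint b c B) = 1 := by
  ext <;> simp [matrixAct, SplitPoint.one_def]

/-- The endomorphism of the split monoid given by an admissible matrix. -/
def matrixEnd (hbc : b ≤ c) (g : Matrix (Fin 2) (Fin 2) L) (hg : IsAdmissible b c g) :
    baseChange (splitMonoid K b c).points L ⟶ baseChange (splitMonoid K b c).points L where
  app B := MonCat.ofHom
    { toFun := fun x : SplitPoint b c B.right => matrixAct (g.map B.hom.hom) x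
      map_one' := matrixAct_map_one _
      map_mul' := matrixAct_map_mul hbc (hg.map B.hom.hom.toRingHom) }
  naturality B B' f := by
    ext x
    have hw : g.map B'.hom.hom = (g.map B.hom.hom).map f.right.hom := by
      rw [← Under.w f]
      rfl
    change matrixAct (g.map B'.hom.hom) (SplitPoint.map b c f.right.hom.toRingHom x) =
      SplitPoint.map b c f.right.hom.toRingHom (matrixAct (g.map B.hom.hom) x)
    refine Eq.trans ?_ (SplitPoint.map_matrixAct f.right.hom.toRingHom _ _).symm
    rw [hw]
    rfl

theorem splitEnd_ext {η θ : baseChange (splitMonoid K b c).points L ⟶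
      baseChange (splitMonoid K b c).points L}
    (h : ∀ (B : Under (CommAlgCat.of K L)) (x : SplitPoint b c B.right),
      (η.app B).hom x = (θ.app B).hom x) : η = θ := by
  ext B x
  exact h B x

theorem matrixEnd_comp (hbc : b ≤ c) (g h : Matrix (Fin 2) (Fin 2) L) (hg : IsAdmissible b c g)
    (hh : IsAdmissible b c h) (hgh : IsAdmissible b c (g * h)) :
    matrixEnd (K := K) hbc h hh ≫ matrixEnd hbc g hg = matrixEnd hbc (g * h) hgh := by
  refine splitEnd_ext fun B x => ?_
  change matrixAct (g.map B.hom.hom) (matrixAct (h.map B.hom.hom) x) =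
    matrixAct ((g * h).map B.hom.hom) x
  refine (matrixAct_mul hbc (hg.map B.hom.hom.toRingHom) (hh.map B.hom.hom.toRingHom) x).symm.trans
    ?_
  exact congrArg (matrixAct · x) (Matrix.map_mul (f := B.hom.hom.toRingHom)).symm

theorem matrixEnd_one (hbc : b ≤ c) (h1 : IsAdmissible b c (1 : Matrix (Fin 2) (Fin 2) L)) :
    matrixEnd (K := K) hbc 1 h1 = 𝟙 _ := by
  refine splitEnd_ext fun B x => ?_
  change matrixAct ((1 : Matrix (Fin 2) (Fin 2) L).map B.hom.hom.toRingHom) x = x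
  rw [Matrix.map_one _ (map_zero _) (map_one _), matrixAct_one]

/-- The action of the group of admissible matrices on the split monoid. -/
def matrixAut (hbc : b ≤ c) : admissible b c L →* AutGroup (splitMonoid K b c) L where
  toFun g :=
    { hom := matrixEnd hbc g.1.val (isAdmissible_val g)
      inv := matrixEnd hbc (g⁻¹).1.val (isAdmissible_val g⁻¹)
      hom_inv_id := by
        have h : (g⁻¹).1.val * g.1.val = 1 := by simp
        refine (matrixEnd_comp hbc _ _ _ _ (by rw [h]; exact fun _ => by simp)).trans ?_
        simp only [h, matrixEnd_one]
      inv_hom_id := by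
        have h : g.1.val * (g⁻¹).1.val = 1 := by simp
        refine (matrixEnd_comp hbc _ _ _ _ (by rw [h]; exact fun _ => by simp)).trans ?_
        simp only [h, matrixEnd_one] }
  map_one' := Iso.ext (matrixEnd_one hbc fun _ => by simp)
  map_mul' g h := Iso.ext (matrixEnd_comp hbc g.1.val h.1.val (isAdmissible_val g)
    (isAdmissible_val h) (isAdmissible_val (g * h))).symm

/-- By the Yoneda lemma, an endomorphism is given by polynomials with coefficients in `L`. -/
theorem exists_polyEval (η : baseChange (splitMonoid K b c).points L ⟶
      baseChange (splitMonoid K b c).points L) :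
    ∃ P : SplitPoint b c (MvPolynomial (Fin 3) L),
      ∀ (B : Under (CommAlgCat.of K L)) (x : SplitPoint b c B.right),
        (η.app B).hom x = polyEval B.hom.hom.toRingHom P x := by
  -- The coordinate ring of `M ⊗ L` carries the universal point; every other point is its image
  -- under evaluation.
  let U : Under (CommAlgCat.of K L) := Under.mk (Y := CommAlgCat.of K (MvPolynomial (Fin 3) L))
    (CommAlgCat.ofHom (IsScalarTower.toAlgHom K L (MvPolynomial (Fin 3) L)))
  refine ⟨(η.app U).hom (genericPoint b c L), fun B x => ?_⟩
  let ev : MvPolynomial (Fin 3) L →ₐ[K] B.right :=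
    { MvPolynomial.eval₂Hom B.hom.hom.toRingHom ![x.x₁, x.x₂, x.x₃] with
      commutes' := fun r => by
        change MvPolynomial.eval₂Hom B.hom.hom.toRingHom ![x.x₁, x.x₂, x.x₃]
          (MvPolynomial.C (algebraMap K L r)) = _
        rw [MvPolynomial.eval₂Hom_C]
        exact B.hom.hom.commutes r }
  let f : U ⟶ B := Under.homMk (CommAlgCat.ofHom ev) (by
    ext l
    exact MvPolynomial.eval₂Hom_C _ _ _)
  have hnat := ConcreteCategory.congr_hom (η.naturality f) (genericPoint b c L)
  change (η.app B).hom (SplitPoint.map b c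
    (MvPolynomial.eval₂Hom B.hom.hom.toRingHom ![x.x₁, x.x₂, x.x₃]) (genericPoint b c L)) = _ at hnat
  rw [map_genericPoint] at hnat
  exact hnat

theorem polyEval_genericPoint {B : Type u} [CommRing B] (h : L →+* B)
    (g : Matrix (Fin 2) (Fin 2) L) (x : SplitPoint b c B) :
    polyEval h (matrixAct (g.map MvPolynomial.C) (genericPoint b c L)) x =
      matrixAct (g.map h) x := by
  rw [polyEval, SplitPoint.map_matrixAct, map_genericPoint]
  congr 1
  ext i j
  simp

/-- The matrix is found on `L`-points alone, which determine the polynomials because `L` is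
infinite; the polynomial identity then holds over every `L`-algebra. -/
theorem exists_matrixEnd [CharZero L] (hbc : b ≤ c) (a : AutGroup (splitMonoid K b c) L) :
    ∃ (g : Matrix (Fin 2) (Fin 2) L) (hg : IsAdmissible b c g),
      a.hom = matrixEnd hbc g hg := by
  obtain ⟨P, hP⟩ := exists_polyEval a.hom
  obtain ⟨Q, hQ⟩ := exists_polyEval a.inv
  let B : Under (CommAlgCat.of K L) := Under.mk (𝟙 (CommAlgCat.of K L))
  have hPB : ∀ x : SplitPoint b c L, (a.hom.app B).hom x = polyEval (RingHom.id L) P x := hP B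
  have hQB : ∀ x : SplitPoint b c L, (a.inv.app B).hom x = polyEval (RingHom.id L) Q x := hQ B
  obtain ⟨g, hg, hPg⟩ := exists_matrix_of_polynomial_aut hbc P Q
    (by rw [← hPB]; exact map_one _)
    (fun x y => by simp only [← hPB]; exact map_mul (a.hom.app B).hom x y)
    (by rw [← hQB]; exact map_one _)
    (fun x y => by simp only [← hQB]; exact map_mul (a.inv.app B).hom x y)
    (fun x => by
      rw [← hQB]
      refine (hPB _).symm.trans ?_
      exact ConcreteCategory.congr_hom (NatTrans.congr_app a.inv_hom_id B) x)
  refine ⟨g, hg, splitEnd_ext fun B x => ?_⟩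
  rw [hP, hPg, polyEval_genericPoint]
  rfl

theorem matrixEnd_injective (hbc : b ≤ c) {g h : Matrix (Fin 2) (Fin 2) L}
    {hg : IsAdmissible b c g} {hh : IsAdmissible b c h}
    (H : matrixEnd (K := K) hbc g hg = matrixEnd hbc h hh) : g = h := by
  let B : Under (CommAlgCat.of K L) := Under.mk (𝟙 (CommAlgCat.of K L))
  refine matrix_eq_of_matrixAct_eq (b := b) (c := c) fun x => ?_
  exact ConcreteCategory.congr_hom (NatTrans.congr_app H B) x

theorem matrixAut_bijective [CharZero L] (hbc : b ≤ c) :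
    Function.Bijective (matrixAut (K := K) (L := L) hbc) := by
  refine ⟨fun g h H => ?_, fun a => ?_⟩
  · exact Subtype.ext (Units.ext (matrixEnd_injective hbc (hg := isAdmissible_val g)
      (hh := isAdmissible_val h) (congrArg Iso.hom H)))
  · obtain ⟨g, hg, ha⟩ := exists_matrixEnd hbc a
    -- The matrix of `a⁻¹` inverts that of `a`, since matrices act faithfully.
    obtain ⟨h, hh, hb⟩ := exists_matrixEnd hbc a⁻¹
    have hadm : ∀ {g h : Matrix (Fin 2) (Fin 2) L}, IsAdmissible b c g → IsAdmissible b c h →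
        IsAdmissible b c (g * h) := by
      intro g h hg hh hlt
      simp [Matrix.mul_apply, Fin.sum_univ_two, hg hlt, hh hlt]
    have h1 : IsAdmissible b c (1 : Matrix (Fin 2) (Fin 2) L) := fun _ => by simp
    have hgh : g * h = 1 := by
      refine matrixEnd_injective (K := K) hbc (hg := hadm hg hh) (hh := h1) ?_
      rw [← matrixEnd_comp hbc g h hg hh, matrixEnd_one, ← ha, ← hb]
      exact a.inv_hom_id
    have hhg : h * g = 1 := mul_eq_one_comm.mp hgh
    exact ⟨⟨⟨g, h, hgh, hhg⟩, hg⟩, Iso.ext ha.symm⟩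

/-- The automorphism group of the split monoid is the group of admissible matrices. -/
def autEquiv [CharZero L] (hbc : b ≤ c) :
    admissible b c L ≃* AutGroup (splitMonoid K b c) L :=
  MulEquiv.ofBijective (matrixAut hbc) (matrixAut_bijective hbc)

/-- Naturality in the field; for `h` an automorphism of `L` it is the Galois equivariance that turns
cocycles of automorphisms into cocycles of matrices. -/
theorem autMap_autEquiv {L' : Type u} [Field L'] [Algebra K L'] [CharZero L] [CharZero L']
    (hbc : b ≤ c) (h : L →ₐ[K] L') (g : admissible b c L) (g' : admissible b c L')
    (hg : g'.1 = Matrix.GeneralLinearGroup.map h.toRingHom g.1) :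
    autEquiv hbc g' = autMap (splitMonoid K b c) h (autEquiv hbc g) := by
  refine Iso.ext (splitEnd_ext fun B x => ?_)
  change matrixAct (g'.1.val.map B.hom.hom) x = matrixAct (g.1.val.map (B.hom.hom ∘ h)) x
  rw [hg]
  rfl

/-- Every cocycle of a finite Galois group with values in the automorphism group of the split
monoid is a coboundary. -/
theorem exists_eq_mul_smul_inv [CharZero K] [FiniteDimensional K L] (hbc : b ≤ c)
    (f : Cocycle (L ≃ₐ[K] L) (AutGroup (splitMonoid K b c) L)) :
    ∃ a : AutGroup (splitMonoid K b c) L, ∀ σ, f.toFun σ = a * (σ • a)⁻¹ := by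
  have : CharZero L := charZero_of_injective_algebraMap (algebraMap K L).injective
  let e := autEquiv (K := K) (L := L) hbc
  let F : (L ≃ₐ[K] L) → GL (Fin 2) L := fun σ => (e.symm (f.toFun σ)).1
  let m (σ : L ≃ₐ[K] L) (g : admissible b c L) : admissible b c L :=
    ⟨Matrix.GeneralLinearGroup.map (σ : L →ₐ[K] L).toRingHom g.1,
      g.2.map (σ : L →ₐ[K] L).toRingHom⟩
  have hm : ∀ σ g, e (m σ g) = σ • e g := fun σ g => autMap_autEquiv hbc _ g (m σ g) rfl
  obtain ⟨P, hP, hP0⟩ := exists_eq_mul_map_inv F (fun τ ρ => by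
    have : e.symm (f.toFun (τ * ρ)) = e.symm (f.toFun τ) * m τ (e.symm (f.toFun ρ)) := by
      apply e.injective
      rw [map_mul, hm]
      simp [f.map_mul]
    exact congrArg Subtype.val this)
  let p : admissible b c L := ⟨P, fun hlt => hP0 fun σ => (e.symm (f.toFun σ)).2 hlt⟩
  refine ⟨e p, fun σ => ?_⟩
  rw [← hm, ← map_inv, ← map_mul, ← MulEquiv.symm_apply_eq]
  exact Subtype.ext (hP σ)

theorem H1_split_eq_base [CharZero K] [FiniteDimensional K L] (hbc : b ≤ c)
    (x : H1 (L ≃ₐ[K] L) (AutGroup (splitMonoid K b c) L)) : x = H1.base _ _ := by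
  induction x using Quotient.inductionOn with
  | h f =>
    obtain ⟨a, ha⟩ := exists_eq_mul_smul_inv hbc f
    refine Quotient.sound ⟨a⁻¹, fun σ => ?_⟩
    change 1 = _
    rw [ha, smul_inv']
    group

end AutSplit

/-! ### Descent for functors of points -/

section Descent

open TensorProduct

variable {K : Type u} [Field K] (L : Type u) [Field L] [Algebra K L]

/-- The extension of scalars `B ⊗ L` of a `K`-algebra `B`. -/
abbrev extendScalars (B : CommAlgCat.{u} K) : CommAlgCat.{u} K := CommAlgCat.of K (B ⊗[K] L)

/-- The homomorphism `B → B ⊗ L`. -/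
def toExtendScalars (B : CommAlgCat.{u} K) : B ⟶ extendScalars L B :=
  CommAlgCat.ofHom Algebra.TensorProduct.includeLeft

/-- The homomorphism `L → B ⊗ L`. -/
def ofExtendScalars (B : CommAlgCat.{u} K) : CommAlgCat.of K L ⟶ extendScalars L B :=
  CommAlgCat.ofHom Algebra.TensorProduct.includeRight

/-- The sheaf condition of a set-valued functor for all the coverings `B → B ⊗ L`. -/
structure HasDescent (F : CommAlgCat.{u} K ⥤ Type u) : Prop where
  injective (B : CommAlgCat.{u} K) : Function.Injective (F.map (toExtendScalars L B))
  exists_map_eq (B : CommAlgCat.{u} K) (t : F.obj (extendScalars L B))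
    (ht : ∀ (C : CommAlgCat.{u} K) (g₁ g₂ : extendScalars L B ⟶ C),
      toExtendScalars L B ≫ g₁ = toExtendScalars L B ≫ g₂ → F.map g₁ t = F.map g₂ t) :
    ∃ d, F.map (toExtendScalars L B) d = t

variable {L}

theorem HasDescent.of_iso {F G : CommAlgCat.{u} K ⥤ Type u} (i : F ≅ G) (hG : HasDescent L G) :
    HasDescent L F where
  injective B x y h := by
    have hx : ∀ x, G.map (toExtendScalars L B) (i.hom.app B x) =
        i.hom.app _ (F.map (toExtendScalars L B) x) :=
      fun x => (NatTrans.naturality_apply i.hom _ x).symm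
    have := hG.injective B ((hx x).trans ((congrArg (i.hom.app _) h).trans (hx y).symm))
    simpa using congrArg (i.inv.app B) this
  exists_map_eq B t ht := by
    obtain ⟨d, hd⟩ := hG.exists_map_eq B (i.hom.app _ t) (fun C g₁ g₂ hg => by
      rw [← NatTrans.naturality_apply, ← NatTrans.naturality_apply, ht C g₁ g₂ hg])
    refine ⟨i.inv.app B d, ?_⟩
    rw [← NatTrans.naturality_apply, hd]
    simp

variable (L) in
/-- The functor of points of a scheme satisfies descent, because faithfully flat morphisms of affine
schemes are effective epimorphisms. -/
theorem hasDescent_functorOfPoints (X : Over (Spec (CommRingCat.of K))) :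
    HasDescent L (functorOfPoints K X) := by
  have hepi : ∀ B : CommAlgCat.{u} K,
      EffectiveEpi ((algSpec (CommRingCat.of K)).map (toExtendScalars L B).op).left := by
    intro B
    have hff : (algebraMap B (B ⊗[K] L)).FaithfullyFlat :=
      (RingHom.faithfullyFlat_algebraMap_iff).mpr inferInstance
    obtain ⟨h₁, h₂⟩ :=
      (flat_and_surjective_SpecMap_iff (CommRingCat.ofHom (algebraMap B (B ⊗[K] L)))).mpr hff
    exact inferInstanceAs (EffectiveEpi (Spec.map (CommRingCat.ofHom (algebraMap B (B ⊗[K] L)))))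
  refine ⟨fun B x y h => ?_, fun B t ht => ?_⟩
  · have := hepi B
    refine Over.OverMorphism.ext ?_
    rw [← cancel_epi ((algSpec (CommRingCat.of K)).map (toExtendScalars L B).op).left]
    exact congrArg CommaMorphism.left h
  · have := hepi B
    let p := (algSpec (CommRingCat.of K)).map (toExtendScalars L B).op
    let t' : (algSpec (CommRingCat.of K)).obj (op (extendScalars L B)) ⟶ X := t
    have key : ∀ {Z : Scheme.{u}} (g₁ g₂ : Z ⟶ ((algSpec (CommRingCat.of K)).obj
        (op (extendScalars L B))).left), g₁ ≫ p.left = g₂ ≫ p.left →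
        g₁ ≫ t'.left = g₂ ≫ t'.left := by
      intro Z g₁ g₂ hg
      -- The hypothesis `ht` only tests `K`-algebras, so `Z` is covered by affines, each made a
      -- `K`-algebra through `g₁`. The map `g₂` induces the same structure because the two agree
      -- after `p`.
      refine Scheme.Cover.hom_ext Z.affineCover _ _ fun i => ?_
      let R := Z.affineOpenCover.X i
      let u : Spec R ⟶ Z := Z.affineCover.f i
      let s := u ≫ g₁ ≫ ((algSpec (CommRingCat.of K)).obj (op (extendScalars L B))).hom
      let _ : Algebra K R := (Spec.preimage s).hom.toAlgebra
      let C : CommAlgCat.{u} K := CommAlgCat.of K R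
      have hs : ((algSpec (CommRingCat.of K)).obj (op C)).hom = s := Spec.map_preimage s
      let k₁ : (algSpec (CommRingCat.of K)).obj (op C) ⟶
          (algSpec (CommRingCat.of K)).obj (op (extendScalars L B)) :=
        Over.homMk (u ≫ g₁) (by rw [hs]; exact Category.assoc _ _ _)
      let k₂ : (algSpec (CommRingCat.of K)).obj (op C) ⟶
          (algSpec (CommRingCat.of K)).obj (op (extendScalars L B)) :=
        Over.homMk (u ≫ g₂) (by
          rw [hs]
          change (u ≫ g₂) ≫ _ = u ≫ g₁ ≫ _
          rw [← Over.w p, reassoc_of% hg, Category.assoc])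
      have hk : k₁ ≫ p = k₂ ≫ p := by
        refine Over.OverMorphism.ext ?_
        change (u ≫ g₁) ≫ p.left = (u ≫ g₂) ≫ p.left
        rw [Category.assoc, hg, Category.assoc]
      obtain ⟨f₁, hf₁⟩ := (algSpec.fullyFaithful (R := CommRingCat.of K)).map_surjective k₁
      obtain ⟨f₂, hf₂⟩ := (algSpec.fullyFaithful (R := CommRingCat.of K)).map_surjective k₂
      have hf : f₁ ≫ (toExtendScalars L B).op = f₂ ≫ (toExtendScalars L B).op := by
        apply (algSpec.fullyFaithful (R := CommRingCat.of K)).map_injective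
        rw [Functor.map_comp, Functor.map_comp, hf₁, hf₂]
        exact hk
      have := ht C f₁.unop f₂.unop (congrArg Quiver.Hom.unop hf)
      change (algSpec (CommRingCat.of K)).map f₁ ≫ t' =
        (algSpec (CommRingCat.of K)).map f₂ ≫ t' at this
      rw [hf₁, hf₂] at this
      have := congrArg CommaMorphism.left this
      change (u ≫ g₁) ≫ t'.left = (u ≫ g₂) ≫ t'.left at this
      exact (Category.assoc _ _ _).symm.trans (this.trans (Category.assoc _ _ _))
    let d := EffectiveEpi.desc p.left t'.left key
    have hd : p.left ≫ d = t'.left := EffectiveEpi.fac p.left t'.left key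
    refine ⟨Over.homMk d ?_, ?_⟩
    · rw [← cancel_epi p.left, reassoc_of% hd]
      exact (Over.w t').trans (Over.w p).symm
    · exact Over.OverMorphism.ext hd

theorem AlgebraicMonoid.hasDescent (M : AlgebraicMonoid K) :
    HasDescent L (M.points ⋙ forget MonCat.{u}) :=
  .of_iso M.pointsIso (hasDescent_functorOfPoints L M.variety)

theorem map_map_eq_of_comp_eq (F : CommAlgCat.{u} K ⥤ MonCat.{u}) {A B B' C : CommAlgCat.{u} K}
    {f : A ⟶ B} {g : B ⟶ C} {f' : A ⟶ B'} {g' : B' ⟶ C} (h : f ≫ g = f' ≫ g') (x : F.obj A) :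
    (F.map g).hom ((F.map f).hom x) = (F.map g').hom ((F.map f').hom x) := by
  have : F.map f ≫ F.map g = F.map f' ≫ F.map g' := by
    rw [← F.map_comp, h, F.map_comp]
  exact ConcreteCategory.congr_hom this x

/-- An isomorphism over `L` which does not depend on the structure of an `L`-algebra descends. -/
theorem nonempty_iso_of_baseChange_iso {F G : CommAlgCat.{u} K ⥤ MonCat.{u}}
    (hF : HasDescent L (F ⋙ forget MonCat.{u})) (hG : HasDescent L (G ⋙ forget MonCat.{u}))
    (e : baseChange F L ≅ baseChange G L)
    (he : ∀ (C : CommAlgCat.{u} K) (k₁ k₂ : CommAlgCat.of K L ⟶ C),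
      (e.hom.app (Under.mk k₁) : F.obj C ⟶ G.obj C) = e.hom.app (Under.mk k₂)) :
    Nonempty (F ≅ G) := by
  -- By `he`, `e` commutes with every `K`-algebra map between `L`-algebras, whether or not it is
  -- `L`-linear.
  have nat : ∀ {C D : CommAlgCat.{u} K} (k : CommAlgCat.of K L ⟶ C) (l : CommAlgCat.of K L ⟶ D)
      (f : C ⟶ D) (x : F.obj C),
      (e.hom.app (Under.mk l)).hom ((F.map f).hom x) =
        (G.map f).hom ((e.hom.app (Under.mk k)).hom x) := by
    intro C D k l f x
    rw [he D l (k ≫ f)]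
    let f' : Under.mk k ⟶ Under.mk (k ≫ f) := Under.homMk f rfl
    exact ConcreteCategory.congr_hom (e.hom.naturality f') x
  have bij : ∀ (C : CommAlgCat.{u} K) (k : CommAlgCat.of K L ⟶ C),
      Function.Bijective (e.hom.app (Under.mk k)).hom := fun C k =>
    ConcreteCategory.bijective_of_isIso (e.hom.app (Under.mk k))
  -- Apply `e` over `B ⊗ L`. By `nat`, the result has equal images under any two maps that agree on
  -- `B`, so it comes from `G(B)`.
  have ex : ∀ (B : CommAlgCat.{u} K) (x : F.obj B), ∃ y : G.obj B,
      (G.map (toExtendScalars L B)).hom y =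
        (e.hom.app (Under.mk (ofExtendScalars L B))).hom
          ((F.map (toExtendScalars L B)).hom x) := by
    intro B x
    refine hG.exists_map_eq B _ fun C g₁ g₂ hg => ?_
    have h := fun g => nat (ofExtendScalars L B) (ofExtendScalars L B ≫ g₁) (D := C) g
      ((F.map (toExtendScalars L B)).hom x)
    refine (h g₁).symm.trans (Eq.trans ?_ (h g₂))
    refine congrArg (e.hom.app (Under.mk (ofExtendScalars L B ≫ g₁))).hom ?_
    exact map_map_eq_of_comp_eq F hg x
  choose η hη using ex
  have inj : ∀ (B : CommAlgCat.{u} K) {y z : G.obj B},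
      (G.map (toExtendScalars L B)).hom y = (G.map (toExtendScalars L B)).hom z → y = z :=
    fun B _ _ h => hG.injective B h
  have η_nat : ∀ {C D : CommAlgCat.{u} K} (f : C ⟶ D) (x : F.obj C),
      η D ((F.map f).hom x) = (G.map f).hom (η C x) := by
    intro C D f x
    refine inj D ?_
    let f' : extendScalars L C ⟶ extendScalars L D :=
      CommAlgCat.ofHom (Algebra.TensorProduct.map f.hom (AlgHom.id K L))
    have hf : f ≫ toExtendScalars L D = toExtendScalars L C ≫ f' := by
      ext x
      simp [toExtendScalars, f']
    have hF' : (F.map (toExtendScalars L D)).hom ((F.map f).hom x) =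
        (F.map f').hom ((F.map (toExtendScalars L C)).hom x) := map_map_eq_of_comp_eq F hf x
    have hG' : ∀ y, (G.map (toExtendScalars L D)).hom ((G.map f).hom y) =
        (G.map f').hom ((G.map (toExtendScalars L C)).hom y) := map_map_eq_of_comp_eq G hf
    rw [hη, hF', hG', hη, nat (ofExtendScalars L C)]
  have η_bij : ∀ B : CommAlgCat.{u} K, Function.Bijective (η B) := by
    intro B
    refine ⟨fun x y h => ?_, fun y => ?_⟩
    · refine hF.injective B ((bij _ (ofExtendScalars L B)).1 ?_)
      refine (hη B x).symm.trans (Eq.trans ?_ (hη B y))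
      rw [h]
    · obtain ⟨z, hz⟩ := (bij _ (ofExtendScalars L B)).2 ((G.map (toExtendScalars L B)).hom y)
      obtain ⟨x, hx⟩ := hF.exists_map_eq B z fun C g₁ g₂ hg => by
        refine (bij C (ofExtendScalars L B ≫ g₁)).1 ?_
        refine (nat (ofExtendScalars L B) _ g₁ z).trans
          (Eq.trans ?_ (nat (ofExtendScalars L B) _ g₂ z).symm)
        rw [hz]
        exact map_map_eq_of_comp_eq G hg y
      refine ⟨x, inj B ?_⟩
      rw [hη]
      exact (congrArg _ hx).trans hz
  have η_mul : ∀ (B : CommAlgCat.{u} K) (x y : F.obj B), η B (x * y) = η B x * η B y := by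
    intro B x y
    refine inj B ?_
    refine (hη B _).trans ?_
    refine (congrArg (e.hom.app (Under.mk (ofExtendScalars L B))).hom
      (map_mul (F.map (toExtendScalars L B)).hom x y)).trans ?_
    refine (map_mul (e.hom.app (Under.mk (ofExtendScalars L B))).hom _ _).trans ?_
    refine Eq.trans ?_ (map_mul (G.map (toExtendScalars L B)).hom _ _).symm
    rw [hη, hη]
    rfl
  let E (B : CommAlgCat.{u} K) : F.obj B ≃* G.obj B :=
    MulEquiv.mk (Equiv.ofBijective (η B) (η_bij B)) (η_mul B)
  exact ⟨NatIso.ofComponents (fun B => (E B).toMonCatIso) (fun f => by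
    ext x
    exact η_nat f x)⟩

end Descent

/-! ### Homomorphisms from a Galois extension to a local ring -/

/-- For a primitive element `α`, the product of the `k₂ α - k₁ (σ α)` is zero, as `k₂ α` is a root
of the characteristic polynomial of `α`. Two distinct factors differ by a unit, so over a local ring
exactly one is a nonunit; the others cancel and that one is zero. -/
theorem exists_eq_comp_of_isLocalRing {K L R : Type*} [Field K] [Field L] [Algebra K L]
    [FiniteDimensional K L] [IsGalois K L] [CommRing R] [IsLocalRing R] [Algebra K R]
    (k₁ k₂ : L →ₐ[K] R) : ∃ σ : L ≃ₐ[K] L, k₂ = k₁.comp (σ : L →ₐ[K] L) := by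
  classical
  let pb := Field.powerBasisOfFiniteOfSeparable K L
  set α := pb.gen
  have hunit : ∀ σ τ : L ≃ₐ[K] L, σ ≠ τ → IsUnit (k₁ (σ α) - k₁ (τ α)) := by
    intro σ τ hne
    rw [← map_sub]
    refine (IsUnit.mk0 _ (sub_ne_zero.mpr fun h => hne ?_)).map k₁
    exact AlgEquiv.coe_toAlgHom_injective (pb.algHom_ext h)
  have hprod : ∏ σ : L ≃ₐ[K] L, (k₂ α - k₁ (σ α)) = 0 := by
    obtain ⟨q, hq⟩ := (Polynomial.mem_lifts _).mp
      (Algebra.IsInvariant.charpoly_mem_lifts K L (L ≃ₐ[K] L) α)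
    have h0 : Polynomial.aeval α q = 0 := by
      rw [← Polynomial.eval_map_algebraMap, hq, MulSemiringAction.charpoly_eq,
        Polynomial.eval_prod]
      exact Finset.prod_eq_zero (Finset.mem_univ 1) (by simp)
    have h1 : Polynomial.aeval (k₂ α) q = 0 := by
      rw [Polynomial.aeval_algHom_apply, h0, map_zero]
    have h2 : (q.map (algebraMap K R)) = (q.map (algebraMap K L)).map (k₁ : L →+* R) := by
      rw [Polynomial.map_map, k₁.comp_algebraMap]
    rw [← Polynomial.eval_map_algebraMap, h2, hq, MulSemiringAction.charpoly_eq,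
      Polynomial.map_prod, Polynomial.eval_prod] at h1
    simpa using h1
  obtain ⟨σ, hσ⟩ : ∃ σ : L ≃ₐ[K] L, ¬ IsUnit (k₂ α - k₁ (σ α)) := by
    by_contra! h
    refine not_isUnit_zero (M₀ := R) ?_
    rw [← hprod]
    exact IsUnit.prod_univ_iff.mpr h
  have hrest : IsUnit (∏ τ ∈ Finset.univ.erase σ, (k₂ α - k₁ (τ α))) := by
    refine IsUnit.prod_iff.mpr fun τ hτ => ?_
    by_contra h
    refine IsLocalRing.nonunits_add (a := k₂ α - k₁ (τ α)) (b := -(k₂ α - k₁ (σ α))) h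
      (by rwa [mem_nonunits_iff, IsUnit.neg_iff]) ?_
    rw [show k₂ α - k₁ (τ α) + -(k₂ α - k₁ (σ α)) = k₁ (σ α) - k₁ (τ α) by ring]
    exact hunit σ τ (Finset.ne_of_mem_erase hτ).symm
  refine ⟨σ, pb.algHom_ext ?_⟩
  rw [← Finset.mul_prod_erase _ _ (Finset.mem_univ σ)] at hprod
  exact sub_eq_zero.mp ((hrest.mul_left_eq_zero).mp hprod)

/-! ### Twisted forms of the split monoid -/

section TwistedForms

variable {K : Type u} [Field K] {L : Type u} [Field L] [Algebra K L]

/-- The conjugate of an isomorphism over `L` by an automorphism of `L`. -/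
def conjugateIso {F G : CommAlgCat.{u} K ⥤ MonCat.{u}} (σ : L ≃ₐ[K] L)
    (e : baseChange F L ≅ baseChange G L) : baseChange F L ≅ baseChange G L :=
  NatIso.ofComponents
    (fun B => e.app ((Under.map (CommAlgCat.ofHom (σ : L →ₐ[K] L))).obj B))
    (fun f => e.hom.naturality ((Under.map (CommAlgCat.ofHom (σ : L →ₐ[K] L))).map f))

theorem SplitPoint.eq_of_localization {b c : ℕ} {C : Type u} [CommRing C] {x y : SplitPoint b c C}
    (h : ∀ (J : Ideal C) [J.IsMaximal],
      SplitPoint.map b c (algebraMap C (Localization.AtPrime J)) x =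
        SplitPoint.map b c (algebraMap C (Localization.AtPrime J)) y) : x = y := by
  ext
  · refine sub_eq_zero.mp (eq_zero_of_localization _ fun J hJ => ?_)
    rw [map_sub, sub_eq_zero]
    exact congrArg SplitPoint.x₁ (h J)
  · refine sub_eq_zero.mp (eq_zero_of_localization _ fun J hJ => ?_)
    rw [map_sub, sub_eq_zero]
    exact congrArg SplitPoint.x₂ (h J)
  · refine sub_eq_zero.mp (eq_zero_of_localization _ fun J hJ => ?_)
    rw [map_sub, sub_eq_zero]
    exact congrArg SplitPoint.x₃ (h J)

/-- A Galois-invariant isomorphism does not depend on the structure of an `L`-algebra, because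
over a local ring two such structures are conjugate. -/
theorem app_eq_app_of_conjugateIso_eq [FiniteDimensional K L] [IsGalois K L] {b c : ℕ}
    {G : CommAlgCat.{u} K ⥤ MonCat.{u}}
    (e : baseChange (splitMonoid K b c).points L ≅ baseChange G L)
    (he : ∀ σ : L ≃ₐ[K] L, conjugateIso σ e = e) (C : CommAlgCat.{u} K)
    (k₁ k₂ : CommAlgCat.of K L ⟶ C) :
    (e.hom.app (Under.mk k₁) : (splitMonoid K b c).points.obj C ⟶ G.obj C) =
      e.hom.app (Under.mk k₂) := by
  have nat : ∀ {D : CommAlgCat.{u} K} (k : CommAlgCat.of K L ⟶ C) (f : C ⟶ D)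
      (x : SplitPoint b c C),
      (e.hom.app (Under.mk (k ≫ f))).hom (SplitPoint.map b c f.hom.toRingHom x) =
        (G.map f).hom ((e.hom.app (Under.mk k)).hom x) := by
    intro D k f x
    let f' : Under.mk k ⟶ Under.mk (k ≫ f) := Under.homMk f rfl
    exact ConcreteCategory.congr_hom (e.hom.naturality f') x
  have bij : ∀ (D : CommAlgCat.{u} K) (k : CommAlgCat.of K L ⟶ D),
      Function.Bijective (e.hom.app (Under.mk k)).hom := fun D k =>
    ConcreteCategory.bijective_of_isIso (e.hom.app (Under.mk k))
  ext x
  -- Nothing is known about equality in `G` being local, so the comparison is moved to the split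
  -- monoid, where points are triples and equality can be checked at maximal ideals.
  obtain ⟨y, hy⟩ := (bij C k₂).2 ((e.hom.app (Under.mk k₁)).hom x)
  refine Eq.trans ?_ (congrArg (e.hom.app (Under.mk k₂)).hom (?_ : y = x))
  · exact hy.symm
  refine SplitPoint.eq_of_localization (C := C) fun J _ => ?_
  let D : CommAlgCat.{u} K := CommAlgCat.of K (Localization.AtPrime J)
  let loc : C ⟶ D := CommAlgCat.ofHom (IsScalarTower.toAlgHom K C (Localization.AtPrime J))
  have : IsLocalRing D := inferInstanceAs (IsLocalRing (Localization.AtPrime J))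
  obtain ⟨σ, hσ⟩ := exists_eq_comp_of_isLocalRing (k₁ ≫ loc).hom (k₂ ≫ loc).hom
  have hk : k₂ ≫ loc = CommAlgCat.ofHom (σ : L →ₐ[K] L) ≫ k₁ ≫ loc := CommAlgCat.hom_ext hσ
  have happ : (e.hom.app (Under.mk (k₂ ≫ loc)) : (splitMonoid K b c).points.obj D ⟶ G.obj D) =
      e.hom.app (Under.mk (k₁ ≫ loc)) := by
    rw [hk]
    exact congrArg (fun i => i.hom.app (Under.mk (k₁ ≫ loc))) (he σ)
  refine (bij D (k₂ ≫ loc)).1 ?_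
  refine (nat k₂ loc y).trans (Eq.trans ?_ (congrArg
    (fun i : (splitMonoid K b c).points.obj D ⟶ G.obj D =>
      i.hom (SplitPoint.map b c loc.hom.toRingHom x)) happ.symm))
  rw [hy]
  exact (nat k₁ loc x).symm

/-- The split monoid has no non-trivial twisted forms. -/
theorem isIsomorphic_of_isTwistedForm [CharZero K] [FiniteDimensional K L] [IsGalois K L]
    {b c : ℕ} (hbc : b ≤ c) (M' : AlgebraicMonoid K)
    (h : (splitMonoid K b c).IsTwistedForm L M') : (splitMonoid K b c).IsIsomorphic M' := by
  obtain ⟨e⟩ := h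
  -- In order of composition, `f(σ) = e⁻¹ ∘ σ(e)`.
  let f : Cocycle (L ≃ₐ[K] L) (AutGroup (splitMonoid K b c) L) :=
    { toFun := fun σ => conjugateIso σ e ≪≫ e.symm
      map_mul := fun τ ρ => by
        change conjugateIso τ (conjugateIso ρ e) ≪≫ e.symm =
          (conjugateIso τ (conjugateIso ρ e) ≪≫ (conjugateIso τ e).symm) ≪≫
            conjugateIso τ e ≪≫ e.symm
        rw [Iso.trans_assoc, Iso.symm_self_id_assoc] }
  obtain ⟨a, ha⟩ := exists_eq_mul_smul_inv hbc f
  -- From `e⁻¹ ∘ σ(e) = a ∘ σ(a)⁻¹` follows `σ(e ∘ a) = e ∘ a`.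
  let e' : baseChange (splitMonoid K b c).points L ≅ baseChange M'.points L := a ≪≫ e
  refine nonempty_iso_of_baseChange_iso (splitMonoid K b c).hasDescent M'.hasDescent e'
    (app_eq_app_of_conjugateIso_eq e' fun σ => ?_)
  let s : baseChange (splitMonoid K b c).points L ≅ baseChange (splitMonoid K b c).points L := σ • a
  let a' : baseChange (splitMonoid K b c).points L ≅ baseChange (splitMonoid K b c).points L := a
  have hσ : conjugateIso σ e ≪≫ e.symm = s.symm ≪≫ a' := ha σ
  calc conjugateIso σ e' = s ≪≫ conjugateIso σ e := rfl
    _ = s ≪≫ (conjugateIso σ e ≪≫ e.symm) ≪≫ e := by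
      rw [Iso.trans_assoc, Iso.symm_self_id, Iso.trans_refl]
    _ = e' := by
      rw [hσ, Iso.trans_assoc, Iso.self_symm_id_assoc]

end TwistedForms

/-- Each class is the base point at its own level. Inflation from `⊥` also lands in a one-element
set, which links every level to the base point without computing inflation. -/
theorem galoisH1_split_eq_base {K : Type u} [Field K] [CharZero K] {b c : ℕ} (hbc : b ≤ c)
    (x : GaloisH1 (splitMonoid K b c)) : x = GaloisH1.base (splitMonoid K b c) := by
  induction x using Quot.ind with
  | mk x =>
    obtain ⟨E, x⟩ := x
    rw [H1_split_eq_base hbc x]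
    refine (Quot.sound ⟨bot_le, ?_⟩).symm
    exact H1_split_eq_base hbc _

end GaloisMonoid

end

/-! ### Assembly of the four statements -/

theorem proposition5p1 (K : Type u) [Field K] [CharZero K] (b c : ℕ) (hbc : b ≤ c) :
    -- every twisted form of `M` is isomorphic to `M` already over `K`
    (∀ (L : Type u) [Field L] [Algebra K L] [FiniteDimensional K L] [IsGalois K L]
      (M' : GaloisMonoid.AlgebraicMonoid K),
      (GaloisMonoid.splitMonoid K b c).IsTwistedForm L M' →
        (GaloisMonoid.splitMonoid K b c).IsIsomorphic M') ∧
    -- the automorphism group functor is `GL₂` if `b = c`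
    (b = c →
      ∃ θ : ∀ (L : Type u) [Field L] [Algebra K L],
          GL (Fin 2) L ≃* GaloisMonoid.AutGroup (GaloisMonoid.splitMonoid K b c) L,
        (∀ (L L' : Type u) [Field L] [Algebra K L] [Field L'] [Algebra K L'] (h : L →ₐ[K] L')
          (g : GL (Fin 2) L),
          θ L' (Matrix.GeneralLinearGroup.map h.toRingHom g) =
            GaloisMonoid.autMap (GaloisMonoid.splitMonoid K b c) h (θ L g)) ∧
        (∀ (L : Type u) [Field L] [Algebra K L] (g : GL (Fin 2) L)
          (B : Under (CommAlgCat.of K L)) (x : GaloisMonoid.SplitPoint b c B.right),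
          ((θ L g).hom.app B).hom x =
            GaloisMonoid.matrixAct (g.val.map B.hom.hom) x)) ∧
    -- the automorphism group functor is the lower-triangular group if `b < c`
    (b < c →
      ∃ θ : ∀ (L : Type u) [Field L] [Algebra K L],
          GaloisMonoid.lowerTriangular L ≃*
            GaloisMonoid.AutGroup (GaloisMonoid.splitMonoid K b c) L,
        (∀ (L L' : Type u) [Field L] [Algebra K L] [Field L'] [Algebra K L'] (h : L →ₐ[K] L')
          (g : GaloisMonoid.lowerTriangular L),
          θ L' (GaloisMonoid.lowerTriangularMap h.toRingHom g) =
            GaloisMonoid.autMap (GaloisMonoid.splitMonoid K b c) h (θ L g)) ∧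
        (∀ (L : Type u) [Field L] [Algebra K L] (g : GaloisMonoid.lowerTriangular L)
          (B : Under (CommAlgCat.of K L)) (x : GaloisMonoid.SplitPoint b c B.right),
          ((θ L g).hom.app B).hom x =
            GaloisMonoid.matrixAct (g.val.val.map B.hom.hom) x)) ∧
    -- the first Galois cohomology set of the automorphism group is trivial
    (∀ x : GaloisMonoid.GaloisH1 (GaloisMonoid.splitMonoid K b c),
      x = GaloisMonoid.GaloisH1.base (GaloisMonoid.splitMonoid K b c)) := by
  refine ⟨fun L _ _ _ _ M' h => GaloisMonoid.isIsomorphic_of_isTwistedForm hbc M' h, ?_, ?_,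
    GaloisMonoid.galoisH1_split_eq_base hbc⟩
  · rintro rfl
    have hL (L : Type u) [Field L] [Algebra K L] : CharZero L :=
      charZero_of_injective_algebraMap (algebraMap K L).injective
    refine ⟨fun L _ _ => have := hL L
      (Subgroup.topEquiv.symm.trans (MulEquiv.subgroupCongr
        (GaloisMonoid.admissible_eq_top L).symm)).trans (GaloisMonoid.autEquiv hbc), ?_, ?_⟩
    · intro L L' _ _ _ _ h g
      have := hL L
      have := hL L'
      exact GaloisMonoid.autMap_autEquiv hbc h _ _ rfl
    · intro L _ _ g B x
      rfl
  · intro hlt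
    have hL (L : Type u) [Field L] [Algebra K L] : CharZero L :=
      charZero_of_injective_algebraMap (algebraMap K L).injective
    refine ⟨fun L _ _ => have := hL L
      (MulEquiv.subgroupCongr (GaloisMonoid.admissible_eq_lowerTriangular L hlt).symm).trans
        (GaloisMonoid.autEquiv hbc), ?_, ?_⟩
    · intro L L' _ _ _ _ h g
      have := hL L
      have := hL L'
      exact GaloisMonoid.autMap_autEquiv hbc h _ _ rfl
    · intro L _ _ g B x
      rfl
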